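/- There is an absolute constant $C>0$ such that the following holds. Let $p=p(n)\in[0,1]$ satisfy $p(n)\gg \log n/n$, i.e. $\frac{\log n}{n}=o(p(n))$ as $n\to\infty$, and let $G\sim G(n,p(n))$ be the Erdős–Rényi random graph on $n$ vertices. Consider the (pull) voter model with agnostic nodes on $G$: every vertex is either agnostic or has one of a given set of colours (it is then gnostic); when a vertex $v$ is active, it chooses a uniformly random neighbour $u$, copies the colour of $u$ if $u$ is gnostic, and keeps its own state if $u$ is agnostic (an isolated vertex always keeps its state). In each round of the synchronous process all vertices are active simultaneously, with independent choices; in each round of the asynchronous process exactly one vertex, chosen uniformly at random, is active. Rounds are independent. Let $T_a\in\{0,1,2,\dots\}\cup\{\infty\}$ be the number of rounds until no vertex is agnostic. Then, with probability tending to $1$ as $n\to\infty$ over the random graph $G$, every initial configuration $S_0$ with at least one gnostic vertex satisfies $$\mathbb{E}[T_a\mid G,S_0]\le C\log n$$ in the synchronous case; and likewise, with probability tending to $1$ over $G$, every such $S_0$ satisfies $$\mathbb{E}[T_a\mid G,S_0]\le C\,n\log n$$ in the asynchronous case. -/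

import Mathlib

open MeasureTheory ProbabilityTheory Filter Asymptotics
open scoped Topology ENNReal unitInterval

noncomputable section

namespace AgnosticVoter

/-- A configuration assigns to each vertex either a colour `some a` (the vertex is gnostic)
or `none` (the vertex is agnostic). -/
abbrev Config (n : ℕ) (κ : Type*) := Fin n → Option κ

/-- One simultaneous update, where `c v` is the vertex chosen by `v`: if `c v` is agnostic then
`v` keeps its state, and otherwise `v` copies the colour of `c v`. In particular a vertex with
`c v = v` keeps its state. -/
def pull {n : ℕ} {κ : Type*} (c : Fin n → Fin n) (S : Config n κ) : Config n κ :=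
  fun v => match S (c v) with
    | none => S v
    | some a => some a

/-- The random vertex chosen by `v` when it is active: a uniformly random neighbour of `v` in `G`.
An isolated vertex has nobody to copy from; it chooses itself. -/
def neighbourChoice {n : ℕ} (G : SimpleGraph (Fin n)) (v : Fin n) : PMF (Fin n) :=
  open Classical in
  if h : (G.neighborFinset v).Nonempty then PMF.uniformOfFinset (G.neighborFinset v) h
  else PMF.pure v

/-- The law of the choices made in one synchronous round: all vertices choose a random neighbour,
independently of each other. -/
def syncRound {n : ℕ} (G : SimpleGraph (Fin n)) : Measure (Fin n → Fin n) :=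
  Measure.pi fun v => (neighbourChoice G v).toMeasure

/-- The law of the choices made in one asynchronous round: a uniformly random vertex chooses a
random neighbour, all other vertices keep their state. (If there are no vertices, nothing
happens.) -/
def asyncRound {n : ℕ} (G : SimpleGraph (Fin n)) : Measure (Fin n → Fin n) :=
  open Classical in
  if _h : Nonempty (Fin n) then
    ((PMF.uniformOfFintype (Fin n)).bind fun v =>
      (neighbourChoice G v).map fun u => Function.update id v u).toMeasure
  else Measure.dirac id

instance {n : ℕ} (G : SimpleGraph (Fin n)) : IsProbabilityMeasure (syncRound G) := by
  unfold syncRound; infer_instance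

instance {n : ℕ} (G : SimpleGraph (Fin n)) : IsProbabilityMeasure (asyncRound G) := by
  unfold asyncRound; split <;> infer_instance

/-- The configuration after `t` rounds, started from `S₀`, where `ω i` are the choices made in
round `i` (rounds are numbered from `0`). -/
def state {n : ℕ} {κ : Type*} (S₀ : Config n κ) (ω : ℕ → Fin n → Fin n) : ℕ → Config n κ
  | 0 => S₀
  | t + 1 => pull (ω t) (state S₀ ω t)

/-- `T_a`: the first time at which no vertex is agnostic (`⊤` if there is no such time). -/
def clearingTime {n : ℕ} {κ : Type*} (S₀ : Config n κ) (ω : ℕ → Fin n → Fin n) : ℕ∞ :=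
  ⨅ (t : ℕ) (_ : ∀ v, state S₀ ω t v ≠ none), (t : ℕ∞)

/-- `𝔼[T_a]` for the process started from `S₀` whose rounds are driven by independent choices
with law `ν`. -/
def expectedClearingTime {n : ℕ} {κ : Type*} (ν : Measure (Fin n → Fin n))
    [IsProbabilityMeasure ν] (S₀ : Config n κ) : ℝ≥0∞ :=
  ∫⁻ ω, (clearingTime S₀ ω : ℝ≥0∞) ∂(Measure.infinitePi fun _ : ℕ => ν)

end AgnosticVoter

end

/-! Colours are irrelevant: the set `A` of gnostic vertices evolves on its own and never shrinks.
Let `k = |A|` and give `A` the potential `log n - log k + log (1 + n - k)`, which lies between `0`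
and `2 log n` for nonempty `A`. The first logarithm pays for multiplicative growth of a small `A`,
the last for multiplicative decay of a small complement. If a round adds on average at least `a *
min k (n - k)` vertices, and activations of different vertices are not positively correlated, the
potential drops on average by at least `a / (2 (1 + a))` (`integral_potential_gnosticStep_le`).
Additive drift (`expectedClearingTime_le_of_drift`) then bounds the expected time by `2 log n` over
that drop.

The growth rate comes from the graph. By Chernoff and union bounds, with high probability every cut
with `k ≤ n / 2` has more than `p n k / 8` edges and every degree is below `4 p n`
(`tendsto_measure_isBalanced`). A vertex `v` outside `A` pulls from `A` with probability the
fraction of its neighbours in `A`, so the mean gain of a synchronous round is at least the cut size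
over `4 p n`. Thus `a = 1/32`, the drop is `1/66` and `C = 132`. An asynchronous round has `a =
1/(32 n)`, which costs the extra factor `n`. -/

namespace AgnosticVoter

/-! ### Additive drift for chains driven by i.i.d. inputs. -/

section Drift

variable {α β : Type*}

/-- The trajectory started from `x`, driven by the inputs `ω`. -/
def trajectory (step : α → β → β) (x : β) (ω : ℕ → α) : ℕ → β
  | 0 => x
  | t + 1 => step (ω t) (trajectory step x ω t)

lemma trajectory_congr (step : α → β → β) (x : β) {ω ω' : ℕ → α} {t : ℕ}
    (h : ∀ i < t, ω i = ω' i) : trajectory step x ω t = trajectory step x ω' t := by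
  induction t with
  | zero => rfl
  | succ t ih =>
    simp only [trajectory]
    rw [h t (Nat.lt_succ_self t), ih fun i hi => h i (hi.trans (Nat.lt_succ_self t))]

lemma trajectory_mem {step : α → β → β} {J : Set β} (hJ : ∀ c, ∀ x ∈ J, step c x ∈ J)
    {x : β} (hx : x ∈ J) (ω : ℕ → α) (t : ℕ) : trajectory step x ω t ∈ J := by
  induction t with
  | zero => exact hx
  | succ t ih => exact hJ _ _ ih

variable [MeasurableSpace α] [DiscreteMeasurableSpace α] [Finite α]
  [MeasurableSpace β] [DiscreteMeasurableSpace β] [Finite β]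

lemma measurable_trajectory (step : α → β → β) (x : β) (t : ℕ) :
    Measurable fun ω => trajectory step x ω t := by
  induction t with
  | zero => exact measurable_const
  | succ t ih =>
    have h : Measurable fun z : α × β => step z.1 z.2 := .of_discrete
    exact h.comp ((measurable_pi_apply t).prodMk ih)

variable (ν : Measure α) [IsProbabilityMeasure ν]

/-- The state at time `t` is a function of the inputs before `t` only. -/
lemma indepFun_trajectory (step : α → β → β) (x : β) (t : ℕ) :
    IndepFun (fun ω => trajectory step x ω t) (fun ω : ℕ → α => ω t)
      (Measure.infinitePi fun _ : ℕ => ν) := by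
  have hind : iIndepFun (fun (i : ℕ) (ω : ℕ → α) => ω i) (Measure.infinitePi fun _ : ℕ => ν) :=
    iIndepFun_infinitePi (P := fun _ : ℕ => ν) (X := fun _ a => a) (fun _ => measurable_id)
  have h := hind.indepFun_finset (Finset.range t) {t} (by simp) fun i => measurable_pi_apply i
  obtain ⟨c₀⟩ : Nonempty α := nonempty_of_isProbabilityMeasure ν
  -- The filler `c₀` for inputs from time `t` on never influences the state at time `t`.
  have hφ : Measurable fun z : Finset.range t → α =>
      trajectory step x (fun i => if hi : i ∈ Finset.range t then z ⟨i, hi⟩ else c₀) t :=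
    .of_discrete
  have hψ : Measurable fun z : ({t} : Finset ℕ) → α => z ⟨t, by simp⟩ := measurable_pi_apply _
  have htraj : (fun ω => trajectory step x ω t) = (fun z : Finset.range t → α =>
      trajectory step x (fun i => if hi : i ∈ Finset.range t then z ⟨i, hi⟩ else c₀) t) ∘
      fun ω i => ω i := by
    funext ω
    refine trajectory_congr step x fun i hi => ?_
    simp [hi]
  rw [htraj]
  exact h.comp hφ hψ

lemma integral_trajectory_succ (step : α → β → β) (x : β) (f : β → ℝ) (t : ℕ) :
    ∫ ω, f (trajectory step x ω (t + 1)) ∂(Measure.infinitePi fun _ : ℕ => ν) =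
      ∫ ω, (∫ c, f (step c (trajectory step x ω t)) ∂ν)
        ∂(Measure.infinitePi fun _ : ℕ => ν) := by
  set P := Measure.infinitePi fun _ : ℕ => ν
  have hm := measurable_trajectory step x t
  have hmap := (indepFun_iff_map_prod_eq_prod_map_map hm.aemeasurable
    (measurable_pi_apply t).aemeasurable).1 (indepFun_trajectory ν step x t)
  have hev : P.map (fun ω : ℕ → α => ω t) = ν := Measure.infinitePi_map_eval (fun _ => ν) t
  have hP : IsProbabilityMeasure (P.map fun ω => trajectory step x ω t) :=
    Measure.isProbabilityMeasure_map hm.aemeasurable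
  rw [hev] at hmap
  calc ∫ ω, f (trajectory step x ω (t + 1)) ∂P
      = ∫ z, f (step z.2 z.1) ∂(P.map fun ω => (trajectory step x ω t, ω t)) := by
        rw [integral_map (hm.prodMk (measurable_pi_apply t)).aemeasurable
          (Measurable.of_discrete.aestronglyMeasurable)]
        rfl
    _ = ∫ y, ∫ c, f (step c y) ∂ν ∂(P.map fun ω => trajectory step x ω t) := by
        rw [hmap, integral_prod _ .of_finite]
    _ = _ := by
        rw [integral_map hm.aemeasurable (Measurable.of_discrete.aestronglyMeasurable)]

/-- Additive drift: if the nonnegative potential `f` decreases in expectation by at least `δ` in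
each step that starts in `D`, the expected number of visits to `D` is at most `f x / δ`. -/
theorem sum_measureReal_trajectory_mem_le {step : α → β → β} {J D : Set β} {f : β → ℝ} {δ : ℝ}
    (hJ : ∀ c, ∀ x ∈ J, step c x ∈ J) (hf : ∀ x ∈ J, 0 ≤ f x)
    (hdrift : ∀ x ∈ J, ∫ c, f (step c x) ∂ν + D.indicator (fun _ => δ) x ≤ f x)
    {x : β} (hx : x ∈ J) (T : ℕ) :
    δ * ∑ t ∈ Finset.range T,
      (Measure.infinitePi fun _ : ℕ => ν).real {ω | trajectory step x ω t ∈ D} ≤ f x := by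
  set P := Measure.infinitePi fun _ : ℕ => ν
  have hint : ∀ (g : β → ℝ) (t : ℕ), Integrable (fun ω => g (trajectory step x ω t)) P := by
    intro g t
    have hm := measurable_trajectory step x t
    have hP : IsProbabilityMeasure (P.map fun ω => trajectory step x ω t) :=
      Measure.isProbabilityMeasure_map hm.aemeasurable
    exact (Integrable.of_finite (μ := P.map fun ω => trajectory step x ω t)
      (f := g)).comp_measurable hm
  have hstep : ∀ t, ∫ ω, f (trajectory step x ω (t + 1)) ∂P
      + δ * P.real {ω | trajectory step x ω t ∈ D} ≤ ∫ ω, f (trajectory step x ω t) ∂P := by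
    intro t
    have hD : ∫ ω, D.indicator (fun _ => δ) (trajectory step x ω t) ∂P =
        δ * P.real {ω | trajectory step x ω t ∈ D} := by
      have hms : MeasurableSet {ω | trajectory step x ω t ∈ D} :=
        measurable_trajectory step x t (.of_discrete (s := D))
      have : (fun ω => D.indicator (fun _ => δ) (trajectory step x ω t)) =
          {ω | trajectory step x ω t ∈ D}.indicator fun _ => δ := by
        ext ω; simp [Set.indicator]
      rw [this, integral_indicator_const _ hms, smul_eq_mul, mul_comm]
    rw [integral_trajectory_succ, ← hD, ← integral_add
      (hint (fun y => ∫ c, f (step c y) ∂ν) t) (hint (D.indicator fun _ => δ) t)]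
    exact integral_mono
      ((hint (fun y => ∫ c, f (step c y) ∂ν) t).add (hint (D.indicator fun _ => δ) t)) (hint f t)
      fun ω => hdrift _ (trajectory_mem hJ hx ω t)
  have hsum : ∀ T : ℕ, ∫ ω, f (trajectory step x ω T) ∂P + δ * ∑ t ∈ Finset.range T,
      P.real {ω | trajectory step x ω t ∈ D} ≤ f x := by
    intro T
    induction T with
    | zero => simp [trajectory, P]
    | succ T ih => rw [Finset.sum_range_succ, mul_add]; linarith [hstep T]
  have h0 : 0 ≤ ∫ ω, f (trajectory step x ω T) ∂P :=
    integral_nonneg fun ω => hf _ (trajectory_mem hJ hx ω T)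
  linarith [hsum T]

end Drift

/-! ### From the voter model to the chain of gnostic sets. -/

section ClearingTime

variable {n : ℕ} {κ : Type*}

/-- The set of gnostic vertices after one round with choices `c`, if `A` is the set before. -/
def gnosticStep (c : Fin n → Fin n) (A : Finset (Fin n)) : Finset (Fin n) :=
  A ∪ Finset.univ.filter fun v => c v ∈ A

open Classical in
/-- The set of gnostic vertices of a configuration. -/
def gnostic (S : Config n κ) : Finset (Fin n) := {v | S v ≠ none}

lemma mem_gnostic {S : Config n κ} {v : Fin n} : v ∈ gnostic S ↔ S v ≠ none := by
  classical
  exact Finset.mem_filter_univ v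

lemma gnostic_pull (c : Fin n → Fin n) (S : Config n κ) :
    gnostic (pull c S) = gnosticStep c (gnostic S) := by
  ext v
  simp only [mem_gnostic, gnosticStep, pull, Finset.mem_union, Finset.mem_filter,
    Finset.mem_univ, true_and]
  cases S (c v) <;> simp

lemma gnostic_state (S₀ : Config n κ) (ω : ℕ → Fin n → Fin n) (t : ℕ) :
    gnostic (state S₀ ω t) = trajectory gnosticStep (gnostic S₀) ω t := by
  induction t with
  | zero => rfl
  | succ t ih => rw [state, gnostic_pull, ih]; rfl

/-- Every round before the first full one contributes `1` to the sum; if there is no full one, the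
sum is infinite. This turns the expected time into an expected number of visits to non-full sets. -/
lemma clearingTime_le_tsum (S₀ : Config n κ) (ω : ℕ → Fin n → Fin n) :
    (clearingTime S₀ ω : ℝ≥0∞) ≤ ∑' t, {ω | trajectory gnosticStep (gnostic S₀) ω t ∈
      ({Finset.univ}ᶜ : Set (Finset (Fin n)))}.indicator 1 ω := by
  classical
  have hiff : ∀ t, (∀ v, state S₀ ω t v ≠ none) ↔
      trajectory gnosticStep (gnostic S₀) ω t = Finset.univ := by
    intro t
    rw [← gnostic_state, Finset.eq_univ_iff_forall]
    simp [mem_gnostic]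
  by_cases h : ∃ t, trajectory gnosticStep (gnostic S₀) ω t = Finset.univ
  · have hle : clearingTime S₀ ω ≤ (Nat.find h : ℕ∞) :=
      iInf₂_le (Nat.find h) ((hiff _).2 (Nat.find_spec h))
    calc (clearingTime S₀ ω : ℝ≥0∞) ≤ ((Nat.find h : ℕ∞) : ℝ≥0∞) := by exact_mod_cast hle
      _ = ∑ t ∈ Finset.range (Nat.find h), {ω | trajectory gnosticStep (gnostic S₀) ω t ∈
          ({Finset.univ}ᶜ : Set (Finset (Fin n)))}.indicator (1 : (ℕ → Fin n → Fin n) → ℝ≥0∞) ω := by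
        rw [Finset.sum_congr rfl (g := fun _ => (1 : ℝ≥0∞))]
        · simp
        · intro t ht
          have := Nat.find_min h (Finset.mem_range.1 ht)
          simp [this]
      _ ≤ _ := ENNReal.sum_le_tsum _
  · push Not at h
    simp [h]

theorem expectedClearingTime_le_of_drift (ν : Measure (Fin n → Fin n)) [IsProbabilityMeasure ν]
    (S₀ : Config n κ) (hS₀ : ∃ v, S₀ v ≠ none) {f : Finset (Fin n) → ℝ} {δ : ℝ} (hδ : 0 < δ)
    (hf : ∀ A : Finset (Fin n), A.Nonempty → 0 ≤ f A)
    (hdrift : ∀ A : Finset (Fin n), A.Nonempty → A ≠ Finset.univ →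
      ∫ c, f (gnosticStep c A) ∂ν + δ ≤ f A) :
    expectedClearingTime ν S₀ ≤ ENNReal.ofReal (f (gnostic S₀) / δ) := by
  classical
  let _ : MeasurableSpace (Finset (Fin n)) := ⊤
  have _ : DiscreteMeasurableSpace (Finset (Fin n)) := ⟨fun _ => trivial⟩
  set P := Measure.infinitePi fun _ : ℕ => ν
  have hne : (gnostic S₀).Nonempty := by
    obtain ⟨v, hv⟩ := hS₀
    exact ⟨v, by simp [mem_gnostic, hv]⟩
  have hmeas : ∀ t, MeasurableSet {ω | trajectory gnosticStep (gnostic S₀) ω t ∈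
      ({Finset.univ}ᶜ : Set (Finset (Fin n)))} := fun t =>
    measurable_trajectory gnosticStep (gnostic S₀) t (.of_discrete (s := {Finset.univ}ᶜ))
  have hsum := sum_measureReal_trajectory_mem_le ν (step := gnosticStep) (J := {A | A.Nonempty})
    (D := ({Finset.univ}ᶜ : Set (Finset (Fin n)))) (f := f) (δ := δ)
    (fun c A hA => hA.mono Finset.subset_union_left) hf
    (fun A hA => by
      -- The full set is absorbing, so no drop is required there.
      by_cases h : A = Finset.univ
      · subst h
        simp [gnosticStep]
      · simpa [h] using hdrift A hA h) hne
  calc expectedClearingTime ν S₀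
      ≤ ∫⁻ ω, ∑' t, {ω | trajectory gnosticStep (gnostic S₀) ω t ∈
          ({Finset.univ}ᶜ : Set (Finset (Fin n)))}.indicator 1 ω ∂P :=
        lintegral_mono fun ω => clearingTime_le_tsum S₀ ω
    _ = ∑' t, P {ω | trajectory gnosticStep (gnostic S₀) ω t ∈
          ({Finset.univ}ᶜ : Set (Finset (Fin n)))} := by
        rw [lintegral_tsum fun t => (measurable_one.indicator (hmeas t)).aemeasurable]
        exact tsum_congr fun t => lintegral_indicator_one (hmeas t)
    _ ≤ ENNReal.ofReal (f (gnostic S₀) / δ) := by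
        refine ENNReal.tsum_le_of_sum_range_le fun T => ?_
        rw [← ENNReal.ofReal_toReal (a := ∑ t ∈ Finset.range T, _)
          (ENNReal.sum_ne_top.2 fun _ _ => measure_ne_top _ _),
          ENNReal.toReal_sum fun _ _ => measure_ne_top _ _]
        refine ENNReal.ofReal_le_ofReal ?_
        rw [le_div_iff₀ hδ, mul_comm]
        exact hsum T

end ClearingTime

end AgnosticVoter

namespace AgnosticVoter

/-! ### Moments of the number of new gnostic vertices, and the drift of the potential. -/

section Moments

variable {Ω ι : Type*} [MeasurableSpace Ω] [DiscreteMeasurableSpace Ω] [Finite Ω]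
  (ν : Measure Ω) [IsProbabilityMeasure ν]

lemma integral_sum_indicator_one (s : Finset ι) (E : ι → Set Ω) :
    ∫ c, ∑ v ∈ s, (E v).indicator (1 : Ω → ℝ) c ∂ν = ∑ v ∈ s, ν.real (E v) := by
  rw [integral_finsetSum _ fun _ _ => .of_finite]
  exact Finset.sum_congr rfl fun v _ => integral_indicator_one .of_discrete

/-- Expand the square over pairs: off-diagonal terms are bounded by products, and the diagonal costs
at most one extra first moment. -/
lemma integral_sum_indicator_one_sq_le (s : Finset ι) (E : ι → Set Ω)
    (hE : ∀ v ∈ s, ∀ w ∈ s, v ≠ w → ν.real (E v ∩ E w) ≤ ν.real (E v) * ν.real (E w)) :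
    ∫ c, (∑ v ∈ s, (E v).indicator (1 : Ω → ℝ) c) ^ 2 ∂ν ≤
      (∑ v ∈ s, ν.real (E v)) ^ 2 + ∑ v ∈ s, ν.real (E v) := by
  classical
  have h : ∀ c, (∑ v ∈ s, (E v).indicator (1 : Ω → ℝ) c) ^ 2 =
      ∑ v ∈ s, ∑ w ∈ s, (E v ∩ E w).indicator (1 : Ω → ℝ) c := by
    intro c
    rw [sq, Finset.sum_mul_sum]
    refine Finset.sum_congr rfl fun v _ => Finset.sum_congr rfl fun w _ => ?_
    rw [Set.inter_indicator_one, Pi.mul_apply]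
  simp_rw [h]
  rw [integral_finsetSum _ fun _ _ => .of_finite]
  calc ∑ v ∈ s, ∫ c, ∑ w ∈ s, (E v ∩ E w).indicator (1 : Ω → ℝ) c ∂ν
      ≤ ∑ v ∈ s, ∑ w ∈ s, (ν.real (E v) * ν.real (E w) + if v = w then ν.real (E v) else 0) := by
        refine Finset.sum_le_sum fun v hv => ?_
        rw [integral_sum_indicator_one]
        refine Finset.sum_le_sum fun w hw => ?_
        split_ifs with hvw
        · subst hvw
          rw [Set.inter_self]
          nlinarith [measureReal_nonneg (μ := ν) (s := E v)]
        · simpa using hE v hv w hw hvw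
    _ = _ := by
        simp_rw [Finset.sum_add_distrib, sq, Finset.sum_mul_sum]
        congr 1
        refine Finset.sum_congr rfl fun v hv => ?_
        simp [hv]

end Moments

/-- Damping `y` by `x` before the quadratic expansion of the logarithm keeps the lower bound useful
for large `y`. Two moments of `y` then suffice, and `x` can be tuned to them. -/
lemma sub_sq_le_log_one_add {x y : ℝ} (hx : 0 ≤ x) (hx1 : x ≤ 1) (hy : 0 ≤ y) :
    x * y - x ^ 2 * y ^ 2 / 2 ≤ Real.log (1 + y) := by
  have hxy : 0 ≤ x * y := mul_nonneg hx hy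
  have h1 : 2 * (x * y) / (x * y + 2) ≤ Real.log (1 + x * y) := Real.le_log_one_add_of_nonneg hxy
  have h2 : x * y - x ^ 2 * y ^ 2 / 2 ≤ 2 * (x * y) / (x * y + 2) := by
    rw [le_div_iff₀ (by positivity)]
    nlinarith [pow_nonneg hxy 3]
  have h3 : Real.log (1 + x * y) ≤ Real.log (1 + y) :=
    Real.log_le_log (by positivity) (by nlinarith)
  linarith

variable {n : ℕ}

/-- A potential that bounds the time until all vertices are gnostic. -/
noncomputable def potential (A : Finset (Fin n)) : ℝ :=
  Real.log n - Real.log A.card + Real.log (1 + (n - A.card))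

lemma card_le_real (A : Finset (Fin n)) : (A.card : ℝ) ≤ n := by
  exact_mod_cast (Finset.card_le_univ A).trans_eq (Fintype.card_fin n)

lemma one_le_card_real {A : Finset (Fin n)} (hA : A.Nonempty) : (1 : ℝ) ≤ A.card := by
  exact_mod_cast hA.card_pos

lemma potential_nonneg {A : Finset (Fin n)} (hA : A.Nonempty) : 0 ≤ potential A := by
  have h1 := one_le_card_real hA
  have h2 := card_le_real A
  have h3 : Real.log A.card ≤ Real.log n := Real.log_le_log (by linarith) h2
  have h4 : 0 ≤ Real.log (1 + (n - A.card : ℝ)) := Real.log_nonneg (by linarith)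
  unfold potential
  linarith

lemma potential_le {A : Finset (Fin n)} (hA : A.Nonempty) : potential A ≤ 2 * Real.log n := by
  have h1 := one_le_card_real hA
  have h2 := card_le_real A
  have h3 : 0 ≤ Real.log A.card := Real.log_nonneg h1
  have h4 : Real.log (1 + (n - A.card : ℝ)) ≤ Real.log n :=
    Real.log_le_log (by linarith) (by linarith)
  unfold potential
  linarith

lemma card_gnosticStep (c : Fin n → Fin n) (A : Finset (Fin n)) :
    ((gnosticStep c A).card : ℝ) =
      A.card + ∑ v ∈ Aᶜ, {c : Fin n → Fin n | c v ∈ A}.indicator (1 : (Fin n → Fin n) → ℝ) c := by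
  have h : gnosticStep c A = A ∪ Aᶜ.filter fun v => c v ∈ A := by
    ext v
    simp only [gnosticStep, Finset.mem_union, Finset.mem_filter, Finset.mem_univ, true_and,
      Finset.mem_compl]
    tauto
  rw [h, Finset.card_union_of_disjoint
    (disjoint_compl_right.mono_right (Finset.filter_subset _ _))]
  push_cast
  congr 1
  rw [Finset.card_filter]
  push_cast
  refine Finset.sum_congr rfl fun v _ => ?_
  simp [Set.indicator]

lemma potential_gnosticStep_le_of_growth {A : Finset (Fin n)} (hA : A.Nonempty) {N x : ℝ}
    (hN : 0 ≤ N) (hx : 0 ≤ x) (hx1 : x ≤ 1) {B : Finset (Fin n)} (hB : (B.card : ℝ) = A.card + N) :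
    potential B ≤ potential A - (x * (N / A.card) - x ^ 2 * (N / A.card) ^ 2 / 2) := by
  have h1 := one_le_card_real hA
  have h2 := card_le_real B
  have h3 : Real.log B.card = Real.log A.card + Real.log (1 + N / A.card) := by
    rw [← Real.log_mul (by positivity) (by positivity), hB]
    congr 1
    field_simp
  have h4 := sub_sq_le_log_one_add hx hx1 (y := N / A.card) (by positivity)
  have h5 : Real.log (1 + (n - B.card : ℝ)) ≤ Real.log (1 + (n - A.card : ℝ)) :=
    Real.log_le_log (by linarith) (by linarith)
  unfold potential
  linarith

lemma potential_gnosticStep_le_of_shrink {A : Finset (Fin n)} (hA : A.Nonempty) {N : ℝ}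
    (hN : 0 ≤ N) {B : Finset (Fin n)} (hB : (B.card : ℝ) = A.card + N) :
    potential B ≤ potential A - N / (1 + (n - A.card)) := by
  have h1 := one_le_card_real hA
  have h2 := card_le_real B
  have h3 : Real.log A.card ≤ Real.log B.card := Real.log_le_log (by linarith) (by linarith)
  have hpos : 0 < 1 + (n - A.card : ℝ) := by linarith
  have h4 : Real.log (1 + (n - B.card : ℝ)) - Real.log (1 + (n - A.card : ℝ)) ≤
      - (N / (1 + (n - A.card))) := by
    rw [← Real.log_div (by linarith) (by linarith)]
    refine (Real.log_le_sub_one_of_pos (div_pos (by linarith) hpos)).trans_eq ?_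
    rw [hB]
    field_simp
    ring
  unfold potential
  linarith

/-- If a vertex set and its complement are linked well enough and the activations of different
vertices are not positively correlated, then the potential has negative drift. -/
theorem integral_potential_gnosticStep_le (ν : Measure (Fin n → Fin n)) [IsProbabilityMeasure ν]
    {A : Finset (Fin n)} (hA : A.Nonempty) (hA' : A ≠ Finset.univ) {a : ℝ} (ha : 0 < a)
    (hcor : ∀ v ∈ Aᶜ, ∀ w ∈ Aᶜ, v ≠ w →
      ν.real ({c | c v ∈ A} ∩ {c | c w ∈ A}) ≤ ν.real {c | c v ∈ A} * ν.real {c | c w ∈ A})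
    (hmean : a * min (A.card : ℝ) (n - A.card) ≤ ∑ v ∈ Aᶜ, ν.real {c | c v ∈ A}) :
    ∫ c, potential (gnosticStep c A) ∂ν + a / (2 * (1 + a)) ≤ potential A := by
  set E : Fin n → Set (Fin n → Fin n) := fun v => {c | c v ∈ A} with hEdef
  set N : (Fin n → Fin n) → ℝ := fun c => ∑ v ∈ Aᶜ, (E v).indicator (1 : (Fin n → Fin n) → ℝ) c with hNdef
  set μ := ∑ v ∈ Aᶜ, ν.real (E v) with hμ
  have hN0 : ∀ c, 0 ≤ N c := fun c =>
    Finset.sum_nonneg fun v _ => Set.indicator_nonneg (fun _ _ => zero_le_one) _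
  have hcard : ∀ c, ((gnosticStep c A).card : ℝ) = A.card + N c := fun c => card_gnosticStep c A
  have hint1 : ∫ c, N c ∂ν = μ := integral_sum_indicator_one ν Aᶜ E
  have hint2 : ∫ c, N c ^ 2 ∂ν ≤ μ ^ 2 + μ := integral_sum_indicator_one_sq_le ν Aᶜ E hcor
  set k : ℝ := (A.card : ℝ) with hk
  have hk1 : 1 ≤ k := one_le_card_real hA
  have hb1 : k + 1 ≤ n := by
    have h : A.card < Fintype.card (Fin n) := Finset.card_lt_iff_ne_univ A |>.2 hA'
    rw [Fintype.card_fin] at h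
    rw [hk]
    exact_mod_cast h
  rcases le_total k (n - k) with hkn | hkn
  · rw [min_eq_left hkn] at hmean
    set m := μ / k with hm
    have hma : a ≤ m := (le_div_iff₀ (by linarith)).2 hmean
    have hm0 : 0 < m := ha.trans_le hma
    -- This value maximises `x * m - x ^ 2 * (m ^ 2 + m) / 2`, the lower bound for the mean drop.
    set x := 1 / (1 + m) with hx
    have hx0 : 0 ≤ x := by positivity
    have hx1 : x ≤ 1 := by rw [hx, div_le_one (by positivity)]; linarith
    have hstep : ∫ c, potential (gnosticStep c A) ∂ν ≤
        ∫ c, (potential A - (x / k * N c - x ^ 2 / (2 * k ^ 2) * N c ^ 2)) ∂ν := by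
      refine integral_mono .of_finite .of_finite fun c => ?_
      refine (potential_gnosticStep_le_of_growth hA (hN0 c) hx0 hx1 (hcard c)).trans_eq ?_
      rw [← hk]
      field_simp
    rw [integral_sub .of_finite .of_finite, integral_sub .of_finite .of_finite,
      integral_const_mul, integral_const_mul, hint1] at hstep
    simp only [integral_const, probReal_univ, one_smul] at hstep
    have hsq : x ^ 2 / (2 * k ^ 2) * ∫ c, N c ^ 2 ∂ν ≤ x ^ 2 * (m ^ 2 + m) / 2 := by
      calc x ^ 2 / (2 * k ^ 2) * ∫ c, N c ^ 2 ∂ν ≤ x ^ 2 / (2 * k ^ 2) * (μ ^ 2 + μ) := by gcongr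
        _ = x ^ 2 * (m ^ 2 + m / k) / 2 := by rw [hm]; field_simp
        _ ≤ _ := by
          have : m / k ≤ m := div_le_self hm0.le hk1
          gcongr
    have hxm : x / k * μ = x * m := by rw [hm]; field_simp
    have hval : x * m - x ^ 2 * (m ^ 2 + m) / 2 = m / (2 * (1 + m)) := by
      rw [hx]; field_simp; ring
    have hmono : a / (2 * (1 + a)) ≤ m / (2 * (1 + m)) := by
      rw [div_le_div_iff₀ (by positivity) (by positivity)]
      nlinarith
    linarith
  · rw [min_eq_right hkn] at hmean
    have hpos : 0 < 1 + (n - k) := by linarith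
    have hstep : ∫ c, potential (gnosticStep c A) ∂ν ≤
        ∫ c, (potential A - (1 / (1 + (n - k))) * N c) ∂ν := by
      refine integral_mono .of_finite .of_finite fun c => ?_
      refine (potential_gnosticStep_le_of_shrink hA (hN0 c) (hcard c)).trans_eq ?_
      rw [← hk]
      ring
    rw [integral_sub .of_finite .of_finite, integral_const_mul, hint1] at hstep
    simp only [integral_const, probReal_univ, one_smul] at hstep
    -- As `A` is not full, `n - k ≥ 1`, so the shift by `1` in the logarithm loses at most a factor
    -- `2`.
    have hval : a / 2 ≤ 1 / (1 + (n - k)) * μ := by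
      rw [one_div_mul_eq_div, le_div_iff₀ hpos]
      nlinarith
    have hmono : a / (2 * (1 + a)) ≤ a / 2 := by
      gcongr
      linarith
    linarith

end AgnosticVoter

namespace AgnosticVoter

/-! ### Cuts and degrees of the binomial random graph. -/

section RandomGraph

instance {V : Type*} [Countable V] : MeasurableSingletonClass (SimpleGraph V) where
  measurableSet_singleton G := by
    have h : ({G} : Set (SimpleGraph V)) =
        SimpleGraph.edgeSet ⁻¹' (SimpleGraph.edgeSet '' {G}) :=
      (Set.preimage_image_eq _ SimpleGraph.edgeSet_injective).symm
    rw [h, Set.image_singleton]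
    exact SimpleGraph.measurable_edgeSet (MeasurableSet.singleton _)

lemma integral_prod_setBernoulli {ι : Type*} [Fintype ι] (u : Set ι) (p : I)
    (g : ι → Prop → ℝ) :
    ∫ s, ∏ i, g i (i ∈ s) ∂(setBernoulli u p) =
      ∏ i, (p * g i (i ∈ u) + (1 - p) * g i False) := by
  rw [setBernoulli_eq_map, integral_map (by fun_prop)
    (Measurable.of_discrete.aestronglyMeasurable), Measure.infinitePi_eq_pi]
  simp only [Set.mem_ofPred_eq]
  rw [integral_fintype_prod_eq_prod]
  refine Finset.prod_congr rfl fun i _ => ?_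
  rw [integral_add_measure .of_finite .of_finite, integral_smul_nnreal_measure,
    integral_smul_nnreal_measure, integral_dirac, integral_dirac]
  simp [NNReal.smul_def]

variable {n : ℕ}

open Classical in
/-- The number of edges of `G` between `A` and its complement. -/
noncomputable def cutSize (G : SimpleGraph (Fin n)) (A : Finset (Fin n)) : ℕ :=
  ((A ×ˢ Aᶜ).filter fun z => G.Adj z.1 z.2).card

lemma cutSize_compl (G : SimpleGraph (Fin n)) (A : Finset (Fin n)) :
    cutSize G Aᶜ = cutSize G A := by
  classical
  refine Finset.card_bij' (fun z _ => z.swap) (fun z _ => z.swap) ?_ ?_ ?_ ?_ <;>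
    simp +contextual [G.adj_comm]

open Classical in
lemma cutSize_eq_sum (G : SimpleGraph (Fin n)) (A : Finset (Fin n)) :
    cutSize G A = ∑ v ∈ Aᶜ, (A.filter fun u => G.Adj v u).card := by
  rw [cutSize, Finset.card_filter, Finset.sum_product_right]
  refine Finset.sum_congr rfl fun v _ => ?_
  rw [Finset.card_filter]
  simp [G.adj_comm]

open Classical in
lemma cutSize_singleton (G : SimpleGraph (Fin n)) (v : Fin n) :
    cutSize G {v} = (G.neighborFinset v).card := by
  rw [← cutSize_compl, cutSize_eq_sum, compl_compl, Finset.sum_singleton]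
  congr 1
  ext u
  simp only [Finset.mem_filter, Finset.mem_compl, Finset.mem_singleton,
    SimpleGraph.mem_neighborFinset]
  exact ⟨fun h => h.2, fun h => ⟨h.ne', h⟩⟩

lemma card_mul_card_compl (A : Finset (Fin n)) :
    ((A ×ˢ Aᶜ).card : ℝ) = A.card * (n - A.card) := by
  rw [Finset.card_product, Finset.card_compl, Fintype.card_fin, Nat.cast_mul,
    Nat.cast_sub ((Finset.card_le_univ A).trans_eq (Fintype.card_fin n))]

/-- The pairs across the cut are distinct non-loops, each present independently with probability
`p`, so the cut size is binomial. -/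
lemma mgf_cutSize (p : I) (A : Finset (Fin n)) (t : ℝ) :
    mgf (fun G => (cutSize G A : ℝ)) (SimpleGraph.binomialRandom (Fin n) p) t =
      (p * Real.exp t + (1 - p)) ^ (A ×ˢ Aᶜ).card := by
  classical
  have hinj : Set.InjOn (fun z : Fin n × Fin n => s(z.1, z.2)) (A ×ˢ Aᶜ : Finset _) := by
    rintro ⟨a, b⟩ h ⟨c, d⟩ h' heq
    simp only [Finset.coe_product, Set.mem_prod, Finset.mem_coe, Finset.mem_compl] at h h'
    rcases Sym2.eq_iff.1 heq with ⟨rfl, rfl⟩ | ⟨rfl, rfl⟩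
    · rfl
    · exact absurd h.1 h'.2
  set F := (A ×ˢ Aᶜ).image fun z : Fin n × Fin n => s(z.1, z.2) with hF
  have hcard : F.card = (A ×ˢ Aᶜ).card := Finset.card_image_of_injOn hinj
  have hdiag : ∀ e ∈ F, e ∈ (Sym2.diagSetᶜ : Set (Sym2 (Fin n))) := by
    intro e he
    obtain ⟨⟨a, b⟩, hab, rfl⟩ := Finset.mem_image.1 he
    simp only [Finset.mem_product, Finset.mem_compl] at hab
    simp only [Set.mem_compl_iff, Sym2.mem_diagSet, Sym2.mk_isDiag_iff]
    rintro rfl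
    exact hab.2 hab.1
  -- Pairs outside the cut get factor `1`, so that the product can run over all of `Sym2 (Fin n)`.
  let g : Sym2 (Fin n) → Prop → ℝ := fun e P => if e ∈ F then (if P then Real.exp t else 1) else 1
  have hexp : ∀ s : Set (Sym2 (Fin n)),
      Real.exp (t * cutSize (SimpleGraph.fromEdgeSet s) A) = ∏ e, g e (e ∈ s) := by
    intro s
    have hcut : cutSize (SimpleGraph.fromEdgeSet s) A =
        ((A ×ˢ Aᶜ).filter fun z : Fin n × Fin n => s(z.1, z.2) ∈ s).card := by
      unfold cutSize
      congr 1
      ext z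
      simp only [Finset.mem_filter, SimpleGraph.fromEdgeSet_adj, and_congr_right_iff,
        and_iff_left_iff_imp, Finset.mem_product, Finset.mem_compl]
      rintro hz - h
      exact hz.2 (h ▸ hz.1)
    rw [Finset.prod_ite_mem, Finset.univ_inter, hF, Finset.prod_image hinj, Finset.prod_ite,
      Finset.prod_const_one, mul_one, Finset.prod_const, hcut, mul_comm, Real.exp_nat_mul]
  rw [mgf, SimpleGraph.binomialRandom_eq_map, integral_map (by fun_prop)
    (Measurable.of_discrete.aestronglyMeasurable)]
  simp_rw [hexp]
  rw [integral_prod_setBernoulli, ← hcard, ← Finset.prod_const]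
  rw [← Finset.prod_subset (Finset.subset_univ F)]
  · refine Finset.prod_congr rfl fun e he => ?_
    simp [g, he, hdiag e he]
  · intro e _ he
    simp [g, he]

lemma mgf_cutSize_le (p : I) (A : Finset (Fin n)) (t : ℝ) :
    mgf (fun G => (cutSize G A : ℝ)) (SimpleGraph.binomialRandom (Fin n) p) t ≤
      Real.exp (p * (Real.exp t - 1) * (A.card * (n - A.card))) := by
  rw [mgf_cutSize, ← card_mul_card_compl, mul_comm _ ((A ×ˢ Aᶜ).card : ℝ), Real.exp_nat_mul]
  have hp0 := p.2.1
  have hp1 := p.2.2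
  refine pow_le_pow_left₀ ?_ ?_ _
  · have := Real.exp_pos t
    have : 0 ≤ 1 - (p : ℝ) := by linarith
    positivity
  · linarith [Real.add_one_le_exp (p * (Real.exp t - 1) : ℝ)]

/-- Chernoff at `t = -1`: since `n - k ≥ n / 2` and `exp (-1) - 1 ≤ -1/2`, the exponent is at most
`p n k / 8 - p n k / 4`. -/
lemma measureReal_cutSize_le_le (p : I) {A : Finset (Fin n)} (hA : 2 * (A.card : ℝ) ≤ n) :
    (SimpleGraph.binomialRandom (Fin n) p).real {G | (cutSize G A : ℝ) ≤ (p : ℝ) * n * A.card / 8} ≤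
      Real.exp (-(p * n / 8)) ^ A.card := by
  have hp0 := p.2.1
  refine (measure_le_le_exp_mul_mgf _ (t := -1) (by norm_num) .of_finite).trans ?_
  refine (mul_le_mul_of_nonneg_left (mgf_cutSize_le p A (-1)) (Real.exp_pos _).le).trans ?_
  rw [← Real.exp_add, ← Real.exp_nat_mul]
  refine Real.exp_le_exp.2 ?_
  have he : Real.exp (-1) - 1 ≤ -(1 / 2) := by linarith [Real.exp_neg_one_lt_half]
  have h1 : (p : ℝ) * (A.card * (n / 2)) ≤ p * (A.card * (n - A.card)) := by
    gcongr
    linarith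
  have h2 : 0 ≤ (p : ℝ) * (A.card * (n / 2)) := by positivity
  nlinarith

/-- Chernoff at `t = 1`, with exponent at most `-4 p n + 2 p n` because `exp 1 - 1 ≤ 2`. -/
lemma measureReal_le_cutSize_le (p : I) (v : Fin n) :
    (SimpleGraph.binomialRandom (Fin n) p).real {G | 4 * ((p : ℝ) * n) ≤ (cutSize G {v} : ℝ)} ≤
      Real.exp (-(2 * (p * n))) := by
  have hp0 := p.2.1
  refine (measure_ge_le_exp_mul_mgf _ (t := 1) (by norm_num) .of_finite).trans ?_
  refine (mul_le_mul_of_nonneg_left (mgf_cutSize_le p {v} 1) (Real.exp_pos _).le).trans ?_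
  rw [← Real.exp_add]
  refine Real.exp_le_exp.2 ?_
  have he : Real.exp 1 - 1 ≤ 2 := by linarith [Real.exp_one_lt_d9]
  have he0 : 0 ≤ Real.exp 1 - 1 := by linarith [Real.add_one_le_exp (1 : ℝ)]
  rw [Finset.card_singleton, Nat.cast_one, one_mul]
  have h1 : (p : ℝ) * (Real.exp 1 - 1) * (n - 1) ≤ p * 2 * n := by
    have hn : (1 : ℝ) ≤ n := by exact_mod_cast v.pos
    gcongr
    linarith
  linarith

/-- All cuts of `G` have at least, and all degrees of `G` at most, the order of magnitude expected
in the binomial random graph with edge probability `p`. -/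
structure IsBalanced (p : ℝ) (G : SimpleGraph (Fin n)) : Prop where
  lt_cutSize : ∀ A : Finset (Fin n), A.Nonempty → 2 * (A.card : ℝ) ≤ n →
    p * n * A.card / 8 < cutSize G A
  cutSize_singleton_lt : ∀ v, (cutSize G {v} : ℝ) < 4 * (p * n)

lemma measureReal_not_isBalanced_le (p : I) :
    (SimpleGraph.binomialRandom (Fin n) p).real {G | ¬ IsBalanced p G} ≤
      ((1 + Real.exp (-(p * n / 8))) ^ n - 1) + n * Real.exp (-(2 * (p * n))) := by
  classical
  set P := SimpleGraph.binomialRandom (Fin n) p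
  set x := Real.exp (-(p * n / 8 : ℝ))
  set s : Finset (Finset (Fin n)) :=
    Finset.univ.filter fun A => A.Nonempty ∧ 2 * (A.card : ℝ) ≤ n
  have hsub : {G | ¬ IsBalanced (p : ℝ) G} ⊆
      (⋃ A ∈ s, {G : SimpleGraph (Fin n) | (cutSize G A : ℝ) ≤ (p : ℝ) * n * A.card / 8}) ∪
        ⋃ v ∈ (Finset.univ : Finset (Fin n)),
          {G : SimpleGraph (Fin n) | 4 * ((p : ℝ) * n) ≤ (cutSize G {v} : ℝ)} := by
    intro G hG
    by_contra h
    simp only [Set.mem_union, Set.mem_iUnion, not_or, not_exists] at h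
    refine hG ⟨fun A hA hA' => ?_, fun v => ?_⟩
    · exact not_le.1 (h.1 A (Finset.mem_filter.2 ⟨Finset.mem_univ _, hA, hA'⟩))
    · exact not_le.1 (h.2 v (Finset.mem_univ v))
  refine (measureReal_mono hsub).trans ((measureReal_union_le _ _).trans (add_le_add ?_ ?_))
  · calc P.real (⋃ A ∈ s, {G : SimpleGraph (Fin n) | (cutSize G A : ℝ) ≤ (p : ℝ) * n * A.card / 8})
        ≤ ∑ A ∈ s, P.real {G : SimpleGraph (Fin n) | (cutSize G A : ℝ) ≤ (p : ℝ) * n * A.card / 8} :=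
          measureReal_biUnion_finset_le _ _
      _ ≤ ∑ A ∈ s, x ^ A.card := Finset.sum_le_sum fun A hA =>
          measureReal_cutSize_le_le p (Finset.mem_filter.1 hA).2.2
      -- Dropping the size restriction makes the union bound a full binomial sum minus its empty
      -- term.
      _ ≤ ∑ A ∈ Finset.univ.erase (∅ : Finset (Fin n)), x ^ A.card := by
          refine Finset.sum_le_sum_of_subset_of_nonneg (fun A hA => ?_) fun A _ _ => by positivity
          exact Finset.mem_erase.2 ⟨(Finset.mem_filter.1 hA).2.1.ne_empty, Finset.mem_univ _⟩
      _ = (1 + x) ^ n - 1 := by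
          have h := Finset.sum_pow_mul_eq_add_pow x 1 (Finset.univ : Finset (Fin n))
          simp only [one_pow, mul_one, Finset.powerset_univ, Finset.card_univ,
            Fintype.card_fin] at h
          rw [add_comm 1 x, ← h, ← Finset.sum_erase_add _ _ (Finset.mem_univ ∅)]
          simp
  · calc P.real (⋃ v ∈ (Finset.univ : Finset (Fin n)),
          {G : SimpleGraph (Fin n) | 4 * ((p : ℝ) * n) ≤ (cutSize G {v} : ℝ)})
        ≤ ∑ v, P.real {G : SimpleGraph (Fin n) | 4 * ((p : ℝ) * n) ≤ (cutSize G {v} : ℝ)} :=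
          measureReal_biUnion_finset_le _ _
      _ ≤ ∑ _v : Fin n, Real.exp (-(2 * (p * n))) :=
          Finset.sum_le_sum fun v _ => measureReal_le_cutSize_le p v
      _ = _ := by simp

lemma measureReal_not_isBalanced_le_of_log_le (p : I) (hn : 0 < n)
    (hp : 16 * Real.log n ≤ p * n) :
    (SimpleGraph.binomialRandom (Fin n) p).real {G | ¬ IsBalanced p G} ≤
      (Real.exp (n : ℝ)⁻¹ - 1) + (n : ℝ)⁻¹ := by
  have hn' : (0 : ℝ) < n := by exact_mod_cast hn
  have hlog : 0 ≤ Real.log n := Real.log_natCast_nonneg n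
  -- The constant `16` in `hp` is what makes `p * n / 8` an admissible `y`.
  have hexp : ∀ y : ℝ, 2 * Real.log n ≤ y → n * Real.exp (-y) ≤ (n : ℝ)⁻¹ := by
    intro y hy
    calc n * Real.exp (-y) ≤ n * Real.exp (-(2 * Real.log n)) := by gcongr
      _ = (n : ℝ)⁻¹ := by
        rw [← neg_mul, mul_comm, mul_comm (-2 : ℝ), Real.exp_mul, Real.exp_log hn',
          Real.rpow_neg hn'.le, Real.rpow_two]
        field_simp
  refine (measureReal_not_isBalanced_le p).trans (add_le_add (sub_le_sub_right ?_ 1) ?_)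
  · calc (1 + Real.exp (-(p * n / 8))) ^ n ≤ Real.exp (Real.exp (-(p * n / 8))) ^ n := by
          gcongr
          linarith [Real.add_one_le_exp (Real.exp (-(p * n / 8 : ℝ)))]
      _ = Real.exp (n * Real.exp (-(p * n / 8))) := (Real.exp_nat_mul _ _).symm
      _ ≤ Real.exp (n : ℝ)⁻¹ := Real.exp_le_exp.2 (hexp _ (by linarith))
  · exact hexp _ (by linarith)

/-- If `log n / n = o(p)`, then the binomial random graph is balanced with high probability. -/
theorem tendsto_measure_isBalanced {p : ℕ → I}
    (hp : (fun n : ℕ => Real.log n / n) =o[atTop] fun n => (p n : ℝ)) :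
    Tendsto (fun n => SimpleGraph.binomialRandom (Fin n) (p n) {G | IsBalanced (p n) G})
      atTop (𝓝 1) := by
  have hlog : ∀ᶠ n : ℕ in atTop, 16 * Real.log n ≤ p n * n := by
    filter_upwards [hp.bound (show (0 : ℝ) < 1 / 16 by norm_num), eventually_gt_atTop 0]
      with n hn hpos
    have hpos' : (0 : ℝ) < n := by exact_mod_cast hpos
    rw [Real.norm_of_nonneg (div_nonneg (Real.log_natCast_nonneg n) hpos'.le),
      Real.norm_of_nonneg (p n).2.1, div_le_iff₀ hpos'] at hn
    linarith
  have hlim : Tendsto (fun n : ℕ => (Real.exp (n : ℝ)⁻¹ - 1) + (n : ℝ)⁻¹) atTop (𝓝 0) := by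
    have h : Tendsto (fun n : ℕ => (n : ℝ)⁻¹) atTop (𝓝 0) := tendsto_inv_atTop_nhds_zero_nat
    simpa using (((Real.continuous_exp.tendsto 0).comp h).sub_const 1).add h
  have hbad : Tendsto (fun n => (SimpleGraph.binomialRandom (Fin n) (p n)).real
      {G | ¬ IsBalanced (p n : ℝ) G}) atTop (𝓝 0) := by
    refine squeeze_zero' (.of_forall fun n => measureReal_nonneg) ?_ hlim
    filter_upwards [hlog, eventually_gt_atTop 0] with n hn hpos
    exact measureReal_not_isBalanced_le_of_log_le (p n) hpos hn
  have hgood : Tendsto (fun n => (SimpleGraph.binomialRandom (Fin n) (p n)).real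
      {G | IsBalanced (p n : ℝ) G}) atTop (𝓝 1) := by
    have h := hbad.const_sub 1
    rw [sub_zero] at h
    refine h.congr fun n => ?_
    rw [← probReal_compl_eq_one_sub .of_discrete]
    congr 1
    ext G
    simp
  have h := ENNReal.tendsto_ofReal hgood
  rw [ENNReal.ofReal_one] at h
  exact h.congr fun n => ENNReal.ofReal_toReal (measure_ne_top _ _)

end RandomGraph

end AgnosticVoter

namespace AgnosticVoter

/-! ### Growth rates of both kinds of round on a balanced graph. -/

section Rounds

variable {n : ℕ} (G : SimpleGraph (Fin n))

open Classical in
lemma card_div_le_neighbourChoice {d : ℝ} (v : Fin n) (hd : ((G.neighborFinset v).card : ℝ) ≤ d)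
    (A : Finset (Fin n)) :
    ((A.filter fun u => G.Adj v u).card : ℝ) / d ≤
      (neighbourChoice G v).toMeasure.real (A : Set (Fin n)) := by
  by_cases h : (G.neighborFinset v).Nonempty
  · have hfilter : ((G.neighborFinset v).filter fun u => u ∈ (A : Set (Fin n))) =
        A.filter fun u => G.Adj v u := by
      ext u
      simp [and_comm]
    rw [neighbourChoice, dif_pos h, measureReal_def,
      PMF.toMeasure_uniformOfFinset_apply h _ .of_discrete, ENNReal.toReal_div,
      ENNReal.toReal_natCast, ENNReal.toReal_natCast]
    have hpos : (0 : ℝ) < (G.neighborFinset v).card := by exact_mod_cast h.card_pos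
    gcongr
    intro u hu
    simp only [Finset.mem_filter, SimpleGraph.mem_neighborFinset, Finset.mem_coe] at hu ⊢
    exact hu.symm
  -- An isolated vertex chooses itself, but it has no neighbours in `A`, so the left side vanishes.
  · have hempty : (A.filter fun u => G.Adj v u) = ∅ := by
      rw [Finset.filter_eq_empty_iff]
      exact fun u _ huv => h ⟨u, (G.mem_neighborFinset v u).2 huv⟩
    rw [hempty, Finset.card_empty, Nat.cast_zero, zero_div]
    exact measureReal_nonneg

variable {G}

lemma IsBalanced.min_card_le_sum_neighbourChoice {p : ℝ} (hG : IsBalanced p G)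
    {A : Finset (Fin n)} (hA : A.Nonempty) (hA' : A ≠ Finset.univ) :
    1 / 32 * min (A.card : ℝ) (n - A.card) ≤
      ∑ v ∈ Aᶜ, (neighbourChoice G v).toMeasure.real (A : Set (Fin n)) := by
  classical
  have ⟨v₀, _⟩ := hA
  -- Positivity comes for free: any degree is nonnegative and strictly below this bound.
  have hd : 0 < 4 * (p * n) := (Nat.cast_nonneg _).trans_lt (hG.cutSize_singleton_lt v₀)
  have hcompl : ((Aᶜ : Finset (Fin n)).card : ℝ) = n - A.card := by
    rw [Finset.card_compl, Fintype.card_fin,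
      Nat.cast_sub ((Finset.card_le_univ A).trans_eq (Fintype.card_fin n))]
  have hcut : p * n * min (A.card : ℝ) (n - A.card) / 8 ≤ cutSize G A := by
    rcases le_total (A.card : ℝ) (n - A.card) with h | h
    · rw [min_eq_left h]
      exact (hG.lt_cutSize A hA (by linarith)).le
    · rw [min_eq_right h, ← hcompl, ← cutSize_compl]
      refine (hG.lt_cutSize Aᶜ ?_ (by rw [hcompl]; linarith)).le
      rwa [Finset.nonempty_iff_ne_empty, Ne, Finset.compl_eq_empty_iff]
  calc 1 / 32 * min (A.card : ℝ) (n - A.card)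
      = (p * n * min (A.card : ℝ) (n - A.card) / 8) / (4 * (p * n)) := by
        rw [eq_div_iff hd.ne']
        ring
    _ ≤ cutSize G A / (4 * (p * n)) := by gcongr
    _ = ∑ v ∈ Aᶜ, ((A.filter fun u => G.Adj v u).card : ℝ) / (4 * (p * n)) := by
        rw [cutSize_eq_sum, Nat.cast_sum, Finset.sum_div]
    _ ≤ _ := Finset.sum_le_sum fun v _ => card_div_le_neighbourChoice G v
        (by rw [← cutSize_singleton]; exact (hG.cutSize_singleton_lt v).le) A

variable (G)

lemma syncRound_real_mem (v : Fin n) (A : Finset (Fin n)) :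
    (syncRound G).real {c | c v ∈ A} = (neighbourChoice G v).toMeasure.real (A : Set (Fin n)) :=
  (measurePreserving_eval (fun v => (neighbourChoice G v).toMeasure) v).measureReal_preimage
    (MeasurableSet.of_discrete (s := (A : Set (Fin n)))).nullMeasurableSet

lemma syncRound_real_inter {v w : Fin n} (hvw : v ≠ w) (A : Finset (Fin n)) :
    (syncRound G).real ({c | c v ∈ A} ∩ {c | c w ∈ A}) =
      (syncRound G).real {c | c v ∈ A} * (syncRound G).real {c | c w ∈ A} := by
  have hind : iIndepFun (fun (v : Fin n) (c : Fin n → Fin n) => c v) (syncRound G) :=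
    iIndepFun_pi (X := fun _ u => u) fun _ => aemeasurable_id
  have h := (hind.indepFun hvw).measure_inter_preimage_eq_mul (A : Set (Fin n)) (A : Set (Fin n))
    .of_discrete .of_discrete
  rw [measureReal_def, measureReal_def, measureReal_def, ← ENNReal.toReal_mul]
  exact congrArg ENNReal.toReal h

lemma asyncRound_apply (hn : 0 < n) (E : Set (Fin n → Fin n)) :
    asyncRound G E = ∑ x : Fin n, (n : ℝ≥0∞)⁻¹ *
      (neighbourChoice G x).toMeasure {u | Function.update id x u ∈ E} := by
  have hne : Nonempty (Fin n) := ⟨⟨0, hn⟩⟩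
  rw [asyncRound, dif_pos hne, PMF.toMeasure_bind_apply _ _ _ .of_discrete, tsum_fintype]
  refine Finset.sum_congr rfl fun x _ => ?_
  rw [PMF.toMeasure_map_apply _ _ _ .of_discrete .of_discrete, PMF.uniformOfFintype_apply,
    Fintype.card_fin]
  rfl

/-- An inactive `v` keeps `c v = v`, which is outside `A`; only the rounds activating `v` count. -/
lemma asyncRound_real_mem (hn : 0 < n) {v : Fin n} {A : Finset (Fin n)} (hv : v ∉ A) :
    (asyncRound G).real {c | c v ∈ A} =
      (n : ℝ)⁻¹ * (neighbourChoice G v).toMeasure.real (A : Set (Fin n)) := by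
  rw [measureReal_def, asyncRound_apply G hn, Finset.sum_eq_single v]
  · have h : {u | Function.update id v u ∈ {c : Fin n → Fin n | c v ∈ A}} =
        (A : Set (Fin n)) := by
      ext u
      simp
    rw [h, ENNReal.toReal_mul, ENNReal.toReal_inv, ENNReal.toReal_natCast]
    rfl
  · intro x _ hx
    have h : {u | Function.update id x u ∈ {c : Fin n → Fin n | c v ∈ A}} = ∅ := by
      ext u
      simp [Function.update_of_ne hx.symm, hv]
    rw [h, measure_empty, mul_zero]
  · simp

/-- Only one vertex moves per round, so joint activations are impossible and the correlation
hypothesis of the drift bound is immediate. -/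
lemma asyncRound_real_inter (hn : 0 < n) {v w : Fin n} (hvw : v ≠ w) {A : Finset (Fin n)}
    (hv : v ∉ A) (hw : w ∉ A) :
    (asyncRound G).real ({c | c v ∈ A} ∩ {c | c w ∈ A}) = 0 := by
  rw [measureReal_def, asyncRound_apply G hn, Finset.sum_eq_zero, ENNReal.toReal_zero]
  intro x _
  have h : {u | Function.update id x u ∈
      {c : Fin n → Fin n | c v ∈ A} ∩ {c | c w ∈ A}} = ∅ := by
    ext u
    by_cases hx : v = x
    · subst hx
      simp [Function.update_of_ne hvw.symm, hw]
    · simp [Function.update_of_ne hx, hv]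
  rw [h, measure_empty, mul_zero]

variable {G} {κ : Type*}

theorem IsBalanced.expectedClearingTime_syncRound_le {p : ℝ} (hG : IsBalanced p G)
    (S₀ : Config n κ) (hS₀ : ∃ v, S₀ v ≠ none) :
    expectedClearingTime (syncRound G) S₀ ≤ ENNReal.ofReal (132 * Real.log n) := by
  have hne : (gnostic S₀).Nonempty := hS₀.imp fun v hv => mem_gnostic.2 hv
  refine (expectedClearingTime_le_of_drift (syncRound G) S₀ hS₀
    (δ := (1 / 32) / (2 * (1 + 1 / 32))) (by norm_num) (fun A hA => potential_nonneg hA)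
    fun A hA hA' => ?_).trans (ENNReal.ofReal_le_ofReal ?_)
  · refine integral_potential_gnosticStep_le (syncRound G) hA hA' (by norm_num)
      (fun v _ w _ hvw => (syncRound_real_inter G hvw A).le) ?_
    simp_rw [syncRound_real_mem]
    exact hG.min_card_le_sum_neighbourChoice hA hA'
  · have := potential_le hne
    rw [div_le_iff₀ (by norm_num)]
    linarith

theorem IsBalanced.expectedClearingTime_asyncRound_le {p : ℝ} (hG : IsBalanced p G)
    (S₀ : Config n κ) (hS₀ : ∃ v, S₀ v ≠ none) :
    expectedClearingTime (asyncRound G) S₀ ≤ ENNReal.ofReal (132 * (n * Real.log n)) := by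
  have hne : (gnostic S₀).Nonempty := hS₀.imp fun v hv => mem_gnostic.2 hv
  have hn : 0 < n := hS₀.choose.pos
  have hn' : (1 : ℝ) ≤ n := by exact_mod_cast hn
  -- Here `a = 1 / (32 n)`, and `1 + a ≤ 33/32` gives `a / (2 (1 + a)) ≥ 1 / (66 n)`.
  have hδ : (n : ℝ)⁻¹ / 66 ≤ (n : ℝ)⁻¹ * (1 / 32) / (2 * (1 + (n : ℝ)⁻¹ * (1 / 32))) := by
    field_simp
    linarith
  refine (expectedClearingTime_le_of_drift (asyncRound G) S₀ hS₀
    (δ := (n : ℝ)⁻¹ / 66) (by positivity) (fun A hA => potential_nonneg hA)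
    fun A hA hA' => ?_).trans (ENNReal.ofReal_le_ofReal ?_)
  · refine (add_le_add_right hδ _).trans
      (integral_potential_gnosticStep_le (asyncRound G) hA hA' (by positivity) ?_ ?_)
    · intro v hv w hw hvw
      rw [asyncRound_real_inter G hn hvw (Finset.mem_compl.1 hv) (Finset.mem_compl.1 hw)]
      positivity
    · rw [Finset.sum_congr rfl fun v hv => asyncRound_real_mem G hn (Finset.mem_compl.1 hv),
        ← Finset.mul_sum, mul_assoc]
      gcongr
      exact hG.min_card_le_sum_neighbourChoice hA hA'
  · have := potential_le hne
    rw [div_le_iff₀ (by positivity)]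
    field_simp
    linarith

end Rounds

end AgnosticVoter


theorem proposition3 :
    ∃ C : ℝ, 0 < C ∧ ∀ (κ : Type*) (p : ℕ → I),
      (fun n : ℕ => Real.log n / n) =o[atTop] (fun n => (p n : ℝ)) →
      Tendsto (fun n => SimpleGraph.binomialRandom (Fin n) (p n)
        {G | ∀ S₀ : AgnosticVoter.Config n κ, (∃ v, S₀ v ≠ none) →
          AgnosticVoter.expectedClearingTime (AgnosticVoter.syncRound G) S₀
            ≤ ENNReal.ofReal (C * Real.log n)}) atTop (𝓝 1) ∧
      Tendsto (fun n => SimpleGraph.binomialRandom (Fin n) (p n)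
        {G | ∀ S₀ : AgnosticVoter.Config n κ, (∃ v, S₀ v ≠ none) →
          AgnosticVoter.expectedClearingTime (AgnosticVoter.asyncRound G) S₀
            ≤ ENNReal.ofReal (C * (n * Real.log n))}) atTop (𝓝 1) := by
  refine ⟨132, by norm_num, fun κ p hp => ?_⟩
  have h := AgnosticVoter.tendsto_measure_isBalanced hp
  exact ⟨tendsto_of_tendsto_of_tendsto_of_le_of_le h tendsto_const_nhds
      (fun n => measure_mono fun G hG S₀ hS₀ =>
        hG.expectedClearingTime_syncRound_le S₀ hS₀) fun n => prob_le_one,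
    tendsto_of_tendsto_of_tendsto_of_le_of_le h tendsto_const_nhds
      (fun n => measure_mono fun G hG S₀ hS₀ =>
        hG.expectedClearingTime_asyncRound_le S₀ hS₀) fun n => prob_le_one⟩
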